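/- Let $n\ge 1$, let $\mathbb D=\{z\in\mathbb C:|z|<1\}$ and $\mathbb T=\partial\mathbb D$, and let $m_n$ be the normalized Lebesgue measure on the torus $\mathbb T^n$. For $z,w\in\mathbb C^n$ with $z_j\overline{w_j}\ne 1$ for all $j$, respectively $z\in\mathbb D^n$ and $\zeta\in\mathbb T^n$, let $$C(z,w)=\prod_{j=1}^n\frac1{1-z_j\overline{w_j}},\qquad P(z,\zeta)=\frac{C(z,\zeta)\,C(\zeta,z)}{C(z,z)}$$ be the Cauchy and Poisson kernels. Let $\varphi:\mathbb D^n\to\mathbb D$ be holomorphic. Then for every $\alpha\in\mathbb T$ there is a unique finite positive Borel measure $\sigma_\alpha=\sigma_\alpha[\varphi]$ on $\mathbb T^n$ (the Clark measure of $\varphi$ at $\alpha$) such that $$\int_{\mathbb T^n}P(z,\zeta)\,d\sigma_\alpha(\zeta)=\operatorname{Re}\left(\frac{\alpha+\varphi(z)}{\alpha-\varphi(z)}\right)\qquad\text{for all } z\in\mathbb D^n,$$ and for every continuous function $f:\mathbb T^n\to\mathbb C$ the function $\alpha\mapsto\int_{\mathbb T^n}f\,d\sigma_\alpha$ is $m_1$-integrable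 on $\mathbb T$ and $$\int_{\mathbb T}\int_{\mathbb T^n}f\,d\sigma_\alpha\,dm_1(\alpha)=\int_{\mathbb T^n}f\,dm_n.$$ -/

import Mathlib

open MeasureTheory

/-- The unit circle `𝕋` carries its Borel σ-algebra. -/
noncomputable instance Circle.instMeasurableSpaceBorel : MeasurableSpace Circle := borel Circle

instance Circle.instBorelSpaceBorel : BorelSpace Circle := ⟨rfl⟩

namespace ClarkTorus

/-- The torus `𝕋ⁿ`. -/
abbrev Torus (n : ℕ) : Type := Fin n → Circle

/-- The open unit polydisc `𝔻ⁿ` in `ℂⁿ`. -/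
def polydisc (n : ℕ) : Set (Fin n → ℂ) := {z | ∀ j, ‖z j‖ < 1}

/-- Normalized Lebesgue measure `m₁` on `𝕋`: the arc length `dθ / 2π`. -/
noncomputable def circleMeasure : Measure Circle :=
  ENNReal.ofReal (2 * Real.pi)⁻¹ •
    (volume.restrict (Set.Ioc 0 (2 * Real.pi))).map (fun θ : ℝ => Circle.exp θ)

/-- Normalized Lebesgue measure `mₙ` on `𝕋ⁿ`: the product of `n` copies of `m₁`. -/
noncomputable def torusMeasure (n : ℕ) : Measure (Torus n) :=
  Measure.pi fun _ => circleMeasure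

/-- A point of `𝕋ⁿ`, seen as a point of `ℂⁿ`. -/
def Torus.toComplex {n : ℕ} (ζ : Torus n) : Fin n → ℂ := fun j => (ζ j : ℂ)

/-- The Cauchy kernel `C(z, w) = ∏ⱼ 1 / (1 - zⱼ * conj wⱼ)`. -/
noncomputable def cauchyKernel {n : ℕ} (z w : Fin n → ℂ) : ℂ :=
  ∏ j, 1 / (1 - z j * (starRingEnd ℂ) (w j))

/-- The Poisson kernel `P(z, ζ) = C(z, ζ) C(ζ, z) / C(z, z)`. -/
noncomputable def torusPoissonKernel {n : ℕ} (z : Fin n → ℂ) (ζ : Torus n) : ℂ :=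
  cauchyKernel z ζ.toComplex * cauchyKernel ζ.toComplex z / cauchyKernel z z

/-- The Poisson integral `P[μ](z)` of a positive measure `μ` on `𝕋ⁿ`. -/
noncomputable def poissonIntegral {n : ℕ} (μ : Measure (Torus n)) (z : Fin n → ℂ) : ℂ :=
  ∫ ζ, torusPoissonKernel z ζ ∂μ

/-- The defining property of the Clark measure of `φ` at `α`: `μ` is a finite positive Borel
measure on `𝕋ⁿ` with `P[μ] = Re ((α + φ) / (α - φ))` on `𝔻ⁿ`. -/
structure IsClarkMeasure {n : ℕ} (φ : (Fin n → ℂ) → ℂ) (α : Circle)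
    (μ : Measure (Torus n)) : Prop where
  isFiniteMeasure : IsFiniteMeasure μ
  poissonIntegral_eq : ∀ z ∈ polydisc n,
    poissonIntegral μ z = (((((α : ℂ) + φ z) / ((α : ℂ) - φ z)).re : ℝ) : ℂ)

open Classical in
/-- The Clark measure `σ_α[φ]`: the measure with the defining property (and `0` if there were
none). -/
noncomputable def clarkMeasure {n : ℕ} (φ : (Fin n → ℂ) → ℂ) (α : Circle) :
    Measure (Torus n) :=
  if h : ∃ μ, IsClarkMeasure φ α μ then h.choose else 0

end ClarkTorus

namespace ClarkTorus
open Filter Topology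

/-! For fixed α, the function (α + φ)/(α - φ) is holomorphic on the polydisc with nonnegative real
part, so σ_α comes from Herglotz's theorem (`exists_measure_of_re_nonneg`): the dilations to radius
r < 1 give densities of constant mass, and a weak limit as r → 1 is the required measure. Uniqueness
holds because a finite measure is the weak limit of its dilated Poisson integrals
(`tendsto_integral_mul_poissonIntegral`). This in turn rests on the Poisson kernel being an
approximate identity that is symmetric in its two torus points.

For the disintegration, Re((α + w)/(α - w)) is read as a function of α: it is the disc Poisson
kernel at w = φ(rζ), with mean 1 over α. By Fubini, the α-average of the dilated integral of f is
therefore ∫ f dmₙ for every r < 1. Dominated convergence as r → 1 carries this over to the Clark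
measures. -/

/-! ### Normalized measures and Poisson kernels -/

theorem integral_circleMeasure {g : Circle → ℂ} (hg : Continuous g) :
    ∫ ζ, g ζ ∂circleMeasure = (2 * Real.pi)⁻¹ • ∫ θ in (0)..(2 * Real.pi), g (Circle.exp θ) := by
  have h : (0 : ℝ) ≤ (2 * Real.pi)⁻¹ := by positivity
  rw [circleMeasure, integral_smul_measure, ENNReal.toReal_ofReal h,
    intervalIntegral.integral_of_le (by positivity),
    integral_map (by fun_prop) hg.aestronglyMeasurable]

instance isProbabilityMeasure_circleMeasure : IsProbabilityMeasure circleMeasure where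
  measure_univ := by
    have h : (0 : ℝ) ≤ (2 * Real.pi)⁻¹ := by positivity
    rw [circleMeasure, Measure.smul_apply, Measure.map_apply (by fun_prop) MeasurableSet.univ]
    simp only [Set.preimage_univ, Measure.restrict_apply_univ, Real.volume_Ioc, sub_zero, smul_eq_mul]
    rw [← ENNReal.ofReal_mul h, inv_mul_cancel₀ (by positivity), ENNReal.ofReal_one]

instance isProbabilityMeasure_torusMeasure (n : ℕ) : IsProbabilityMeasure (torusMeasure n) := by
  unfold torusMeasure; infer_instance

/-- The Poisson kernel of the disc, as the real part of the Herglotz kernel. -/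
noncomputable def discPoissonKernel (w : ℂ) (ζ : Circle) : ℝ :=
  (((ζ : ℂ) + w) / ((ζ : ℂ) - w)).re

/-- The real Poisson kernel of the polydisc, as a product of one-variable kernels. -/
noncomputable def realPoissonKernel {n : ℕ} (z : Fin n → ℂ) (ζ : Torus n) : ℝ :=
  ∏ j, discPoissonKernel (z j) (ζ j)

theorem circle_sub_ne_zero {w : ℂ} (hw : ‖w‖ < 1) (ζ : Circle) : (ζ : ℂ) - w ≠ 0 := fun h => by
  rw [← sub_eq_zero.1 h, Circle.norm_coe] at hw
  exact lt_irrefl _ hw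

theorem continuous_discPoissonKernel {w : ℂ} (hw : ‖w‖ < 1) :
    Continuous (discPoissonKernel w) :=
  Complex.continuous_re.comp <|
    (continuous_subtype_val.add continuous_const).div
      (continuous_subtype_val.sub continuous_const) (circle_sub_ne_zero hw)

theorem continuous_realPoissonKernel {n : ℕ} {z : Fin n → ℂ} (hz : z ∈ polydisc n) :
    Continuous (realPoissonKernel z) :=
  continuous_finsetProd _ fun j _ =>
    (continuous_discPoissonKernel (hz j)).comp (continuous_apply j)

theorem continuous_toComplex {n : ℕ} : Continuous (Torus.toComplex (n := n)) :=
  continuous_pi fun j => continuous_subtype_val.comp (continuous_apply j)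

/-! ### The Poisson formula for holomorphic functions -/

/-- Serves twice: as the one-variable step of the induction on n, and with f = 1 as the mean over α
in the disintegration. -/
theorem integral_discPoissonKernel_mul {f : ℂ → ℂ} {w : ℂ}
    (hf : DifferentiableOn ℂ f (Metric.closedBall 0 1)) (hw : ‖w‖ < 1) :
    ∫ ζ : Circle, (discPoissonKernel w ζ : ℂ) * f ζ ∂circleMeasure = f w := by
  have hd : DiffContOnCl ℂ f (Metric.ball 0 1) :=
    DifferentiableOn.diffContOnCl (by rwa [closure_ball _ one_ne_zero])
  have := hd.circleAverage_re_herglotzRieszKernel_smul' (w := w) (by simpa using hw)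
  rw [integral_circleMeasure, ← this, Real.circleAverage_def]
  · simp [circleMap, Circle.coe_exp, discPoissonKernel]
  · have hc : Continuous fun ζ : Circle => f ζ :=
      hf.continuousOn.comp_continuous continuous_subtype_val
        (fun ζ => by rw [mem_closedBall_zero_iff, Circle.norm_coe])
    exact (Complex.continuous_ofReal.comp (continuous_discPoissonKernel hw)).mul hc

theorem integrable_of_continuous {X E : Type*} [TopologicalSpace X] [CompactSpace X]
    [MeasurableSpace X] [OpensMeasurableSpace X] [NormedAddCommGroup E]
    [SecondCountableTopologyEither X E] {μ : Measure X}
    [IsFiniteMeasure μ] {f : X → E} (hf : Continuous f) : Integrable f μ :=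
  hf.integrable_of_hasCompactSupport (.of_compactSpace f)

/-- The open polydisc of radius `R`. -/
def radiusPolydisc (n : ℕ) (R : ℝ) : Set (Fin n → ℂ) := {z | ∀ j, ‖z j‖ < R}

theorem toComplex_mem_radiusPolydisc {n : ℕ} {R : ℝ} (hR : 1 < R) (ζ : Torus n) :
    ζ.toComplex ∈ radiusPolydisc n R := fun j => by
  rw [Torus.toComplex, Circle.norm_coe]; exact hR

/-- The Poisson formula for holomorphic functions on a neighbourhood of the closed polydisc. -/
theorem integral_realPoissonKernel_mul {R : ℝ} (hR : 1 < R) {n : ℕ} {F : (Fin n → ℂ) → ℂ}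
    (hF : DifferentiableOn ℂ F (radiusPolydisc n R)) {z : Fin n → ℂ} (hz : z ∈ polydisc n) :
    ∫ ζ, (realPoissonKernel z ζ : ℂ) * F ζ.toComplex ∂torusMeasure n = F z := by
  induction n with
  | zero =>
    have : ∀ ζ : Torus 0, (realPoissonKernel z ζ : ℂ) * F ζ.toComplex = F z := fun ζ => by
      rw [Subsingleton.elim ζ.toComplex z]; simp [realPoissonKernel]
    simp [this]
  | succ n ih =>
    have hc : Continuous fun ζ : Torus (n + 1) => (realPoissonKernel z ζ : ℂ) * F ζ.toComplex :=
      (Complex.continuous_ofReal.comp (continuous_realPoissonKernel hz)).mul <|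
        hF.continuousOn.comp_continuous continuous_toComplex (toComplex_mem_radiusPolydisc hR)
    have hmp := (measurePreserving_piFinSuccAbove (fun _ : Fin (n + 1) => circleMeasure) 0).symm
    rw [torusMeasure, ← hmp.integral_comp']
    have hint := (hmp.integrable_comp_emb (MeasurableEquiv.measurableEmbedding _)).2
      (integrable_of_continuous hc)
    -- Fubini with the first coordinate innermost: the disc formula replaces it by `z 0` for each
    -- fixed y, and the induction hypothesis then applies to the slice `F (Fin.cons (z 0) ·)`.
    refine (integral_prod_symm _ hint).trans ?_
    have hz' : Fin.tail z ∈ polydisc n := fun j => hz j.succ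
    have hmem : ∀ {x : ℂ} {y : Fin n → ℂ}, ‖x‖ < R → y ∈ radiusPolydisc n R →
        (Fin.cons x y : Fin (n + 1) → ℂ) ∈ radiusPolydisc (n + 1) R := fun {x y} hx hy j => by
      refine Fin.cases ?_ (fun i => ?_) j
      · simpa using hx
      · simpa using hy i
    have hcons : ∀ (x : Circle) (y : Torus n),
        Torus.toComplex (Fin.cons x y : Torus (n + 1)) = Fin.cons (x : ℂ) y.toComplex :=
      fun x y => by
        ext j
        refine Fin.cases ?_ (fun i => ?_) j <;> simp [Torus.toComplex]
    have hd2 : Differentiable ℂ fun y : Fin n → ℂ => (Fin.cons (z 0) y : Fin (n + 1) → ℂ) := by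
      rw [differentiable_pi]
      intro j
      refine Fin.cases ?_ (fun i => ?_) j
      · simp
      · simp only [Fin.cons_succ]; fun_prop
    have hd1 : ∀ y : Fin n → ℂ,
        Differentiable ℂ fun x : ℂ => (Fin.cons x y : Fin (n + 1) → ℂ) := fun y => by
      rw [differentiable_pi]
      intro j
      refine Fin.cases ?_ (fun i => ?_) j
      · simp only [Fin.cons_zero]; fun_prop
      · simp
    have := ih (F := fun y => F (Fin.cons (z 0) y)) (z := Fin.tail z)
      (hF.comp hd2.differentiableOn fun y hy => hmem ((hz 0).trans hR) hy) hz'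
    rw [Fin.cons_self_tail] at this
    rw [← this]
    refine integral_congr_ae (.of_forall fun y : Torus n => ?_)
    have h1 := integral_discPoissonKernel_mul (w := z 0) (f := fun x => F (Fin.cons x (Torus.toComplex y)))
      (hF.comp (hd1 _).differentiableOn fun x hx => hmem
        ((mem_closedBall_zero_iff.1 hx).trans_lt hR) (toComplex_mem_radiusPolydisc hR y)) (hz 0)
    dsimp only
    rw [← h1, ← integral_const_mul]
    refine integral_congr_ae (.of_forall fun x => ?_)
    simp only [Function.comp_def, MeasurableEquiv.piFinSuccAbove_symm_apply, Fin.insertNthEquiv,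
      Equiv.coe_fn_mk, Fin.insertNth_zero', hcons, realPoissonKernel, Fin.prod_univ_succ,
      Fin.cons_zero, Fin.cons_succ, Complex.ofReal_mul, Fin.tail]
    ring

/-! ### Product form, positivity and symmetry of the kernel -/

/-- On the circle conj ζ = ζ⁻¹, so both sides are rational in ζ, w and conj w. -/
theorem discPoissonKernel_eq_cauchy {w : ℂ} (hw : ‖w‖ < 1) (ζ : Circle) :
    (discPoissonKernel w ζ : ℂ) =
      1 / (1 - w * (starRingEnd ℂ) ζ) * (1 / (1 - ζ * (starRingEnd ℂ) w)) /
        (1 / (1 - w * (starRingEnd ℂ) w)) := by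
  have h1 := circle_sub_ne_zero hw ζ
  have h0 : (ζ : ℂ) ≠ 0 := Circle.coe_ne_zero ζ
  have h2 : 1 - (ζ : ℂ) * (starRingEnd ℂ) w ≠ 0 := fun h => by
    have := congrArg norm (sub_eq_zero.1 h)
    rw [norm_one, norm_mul, Circle.norm_coe, RCLike.norm_conj] at this
    linarith
  have h3 : 1 - w * (starRingEnd ℂ) w ≠ 0 := fun h => by
    have := congrArg norm (sub_eq_zero.1 h)
    rw [norm_one, norm_mul, RCLike.norm_conj] at this
    nlinarith [norm_nonneg w]
  have h4 : (ζ : ℂ)⁻¹ - (starRingEnd ℂ) w ≠ 0 := fun h => h2 (by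
    rw [sub_eq_zero] at h; rw [← h, mul_inv_cancel₀ h0, sub_self])
  have h5 : 1 - w * (ζ : ℂ)⁻¹ ≠ 0 := fun h => h1 (by
    rw [sub_eq_zero, eq_comm, mul_inv_eq_one₀ h0] at h; rw [h, sub_self])
  rw [discPoissonKernel, Complex.re_eq_add_conj]
  simp only [map_div₀, map_add, map_sub, ← Circle.coe_inv_eq_conj, Circle.coe_inv]
  field_simp
  ring

theorem torusPoissonKernel_eq {n : ℕ} {z : Fin n → ℂ} (hz : z ∈ polydisc n) (ζ : Torus n) :
    torusPoissonKernel z ζ = realPoissonKernel z ζ := by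
  simp only [torusPoissonKernel, cauchyKernel, realPoissonKernel, Complex.ofReal_prod,
    discPoissonKernel_eq_cauchy (hz _), Finset.prod_mul_distrib, Finset.prod_div_distrib,
    Torus.toComplex]

theorem re_add_div_sub (a b : ℂ) :
    ((a + b) / (a - b)).re = (‖a‖ ^ 2 - ‖b‖ ^ 2) / ‖a - b‖ ^ 2 := by
  simpa [poissonKernel, herglotzRieszKernel] using
    (congrFun (poissonKernel_eq_re_herglotzRieszKernel (c := 0) (w := b)) a).symm

theorem realPoissonKernel_nonneg {n : ℕ} {z : Fin n → ℂ} (hz : z ∈ polydisc n) (ζ : Torus n) :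
    0 ≤ realPoissonKernel z ζ := by
  refine Finset.prod_nonneg fun j _ => ?_
  rw [discPoissonKernel, re_add_div_sub, Circle.norm_coe]
  have := hz j
  have := norm_nonneg (z j)
  exact div_nonneg (by nlinarith) (by positivity)

theorem smul_toComplex_mem_polydisc {n : ℕ} {r : ℝ} (h0 : 0 ≤ r) (h1 : r < 1) (ζ : Torus n) :
    (r : ℂ) • ζ.toComplex ∈ polydisc n := fun j => by
  rw [Pi.smul_apply, Torus.toComplex, norm_smul, Circle.norm_coe, mul_one, Complex.norm_real,
    Real.norm_of_nonneg h0]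
  exact h1

/-- Each factor is (1 - r²)/|η - rζ|², and |η - rζ| = |ζ - rη| for unimodular ζ, η. This makes the
dilated Poisson operator self-adjoint under Fubini. -/
theorem realPoissonKernel_symm {n : ℕ} (r : ℝ) (ζ η : Torus n) :
    realPoissonKernel ((r : ℂ) • ζ.toComplex) η = realPoissonKernel ((r : ℂ) • η.toComplex) ζ := by
  refine Finset.prod_congr rfl fun j _ => ?_
  simp only [discPoissonKernel, re_add_div_sub, Pi.smul_apply, Torus.toComplex, norm_smul,
    Circle.norm_coe]
  congr 2
  rw [← Complex.ofReal_inj]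
  have : ∀ z : ℂ, ((‖z‖ ^ 2 : ℝ) : ℂ) = z * (starRingEnd ℂ) z := fun z => by
    rw [Complex.mul_conj, Complex.normSq_eq_norm_sq]
  have h1 : ‖(η j : ℂ) - (r : ℂ) • (ζ j : ℂ)‖ ^ 2 = ‖(ζ j : ℂ) - (r : ℂ) • (η j : ℂ)‖ ^ 2 := by
    rw [← Complex.ofReal_inj, this, this]
    simp only [smul_eq_mul, map_sub, map_mul, Complex.conj_ofReal, ← Circle.coe_inv_eq_conj,
      Circle.coe_inv]
    have := (ζ j).coe_ne_zero
    have := (η j).coe_ne_zero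
    field_simp
  have := (sq_eq_sq₀ (norm_nonneg _) (norm_nonneg _)).1 h1
  rw [this]

/-! ### The Poisson kernel as an approximate identity -/

theorem integral_realPoissonKernel_mul_re {R : ℝ} (hR : 1 < R) {n : ℕ} {F : (Fin n → ℂ) → ℂ}
    (hF : DifferentiableOn ℂ F (radiusPolydisc n R)) {z : Fin n → ℂ} (hz : z ∈ polydisc n) :
    ∫ ζ, realPoissonKernel z ζ * (F ζ.toComplex).re ∂torusMeasure n = (F z).re := by
  have hc : Continuous fun ζ : Torus n => (realPoissonKernel z ζ : ℂ) * F ζ.toComplex :=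
    (Complex.continuous_ofReal.comp (continuous_realPoissonKernel hz)).mul <|
      hF.continuousOn.comp_continuous continuous_toComplex (toComplex_mem_radiusPolydisc hR)
  rw [← integral_realPoissonKernel_mul hR hF hz]
  have := Complex.reCLM.integral_comp_comm (integrable_of_continuous hc (μ := torusMeasure n))
  simpa using this

theorem integral_realPoissonKernel {n : ℕ} {z : Fin n → ℂ} (hz : z ∈ polydisc n) :
    ∫ ζ, realPoissonKernel z ζ ∂torusMeasure n = 1 := by
  simpa using integral_realPoissonKernel_mul_re one_lt_two
    (differentiableOn_const (c := (1 : ℂ))) hz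

/-- On the torus |ζⱼ - ηⱼ|² is the real part of the holomorphic function 2 - 2 zⱼ conj ηⱼ, so the
Poisson formula evaluates it at z = rη. -/
theorem integral_realPoissonKernel_mul_sq {n : ℕ} {r : ℝ} (h0 : 0 ≤ r) (h1 : r < 1) (η : Torus n)
    (j : Fin n) :
    ∫ ζ, realPoissonKernel ((r : ℂ) • η.toComplex) ζ * ‖(ζ j : ℂ) - η j‖ ^ 2 ∂torusMeasure n =
      2 - 2 * r := by
  have hz := smul_toComplex_mem_polydisc h0 h1 η
  have := integral_realPoissonKernel_mul_re one_lt_two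
    (F := fun z => 2 - 2 * (z j * (starRingEnd ℂ) (η j : ℂ))) (by fun_prop) hz
  have hη : (r : ℂ) * (η j : ℂ) * (starRingEnd ℂ) (η j : ℂ) = r := by
    rw [mul_assoc, Complex.mul_conj, Circle.normSq_coe]; simp
  simp only [Pi.smul_apply, Torus.toComplex, smul_eq_mul, hη] at this
  convert this using 1
  · refine integral_congr_ae (.of_forall fun ζ => ?_)
    dsimp only
    congr 1
    have e1 := Circle.normSq_coe (ζ j)
    have e2 := Circle.normSq_coe (η j)
    rw [← Complex.normSq_eq_norm_sq]
    simp only [Complex.normSq_apply, Complex.sub_re, Complex.sub_im, Complex.mul_re,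
      Complex.conj_re, Complex.conj_im, Complex.re_ofNat, Complex.im_ofNat] at *
    linarith
  · simp

/-- On the compact set where g ≥ ε, h is positive; K is the maximum of g divided by the minimum of h
there. As in Korovkin's theorem, concentration of the kernel then need only be tested on h, with no
splitting of integrals into near and far parts. -/
theorem exists_le_add_mul {X : Type*} [TopologicalSpace X] [CompactSpace X] {g h : X → ℝ}
    (hg : Continuous g) (hh : Continuous h) (h_nonneg : ∀ x, 0 ≤ h x)
    (hgh : ∀ x, h x = 0 → g x ≤ 0) {ε : ℝ} (hε : 0 < ε) :
    ∃ K, 0 ≤ K ∧ ∀ x, g x ≤ ε + K * h x := by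
  have hS : IsCompact {x | ε ≤ g x} := (isClosed_le continuous_const hg).isCompact
  rcases Set.eq_empty_or_nonempty {x | ε ≤ g x} with he | hne
  · refine ⟨0, le_rfl, fun x => ?_⟩
    have : x ∉ {x | ε ≤ g x} := by rw [he]; exact Set.notMem_empty x
    rw [zero_mul, add_zero]; exact (not_le.1 this).le
  · obtain ⟨a, ha, hmin⟩ := hS.exists_isMinOn hne hh.continuousOn
    obtain ⟨b, hb, hmax⟩ := hS.exists_isMaxOn hne hg.continuousOn
    have hapos : 0 < h a := (h_nonneg a).lt_of_ne fun e => by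
      have := hgh a e.symm; have : ε ≤ g a := ha; linarith
    have hb' : ε ≤ g b := hb
    refine ⟨g b / h a, div_nonneg (by linarith) hapos.le, fun x => ?_⟩
    by_cases hx : ε ≤ g x
    · have h1 : h a ≤ h x := hmin hx
      have h2 : g x ≤ g b := hmax hx
      have : g b ≤ g b / h a * h x := by
        rw [div_mul_eq_mul_div, le_div_iff₀ hapos]
        exact mul_le_mul_of_nonneg_left h1 (by linarith)
      linarith
    · have : 0 ≤ g b / h a * h x := mul_nonneg (div_nonneg (by linarith) hapos.le) (h_nonneg x)
      linarith

/-- The Poisson kernel is an approximate identity on the torus. -/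
theorem tendsto_integral_realPoissonKernel_mul {n : ℕ} {f : Torus n → ℂ} (hf : Continuous f)
    (η : Torus n) :
    Tendsto (fun r : ℝ => ∫ ζ, (realPoissonKernel ((r : ℂ) • η.toComplex) ζ : ℂ) * f ζ
      ∂torusMeasure n) (𝓝[<] 1) (𝓝 (f η)) := by
  rw [Metric.tendsto_nhds]
  intro ε hε
  -- A test function vanishing only at η, whose Poisson integral at rη is exactly n(2 - 2r).
  set h : Torus n → ℝ := fun ζ => ∑ j, ‖(ζ j : ℂ) - η j‖ ^ 2 with hh
  have hhc : Continuous h := continuous_finsetSum _ fun j _ =>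
    (((continuous_subtype_val.comp (continuous_apply j)).sub continuous_const).norm).pow 2
  obtain ⟨K, hK, hle⟩ := exists_le_add_mul (g := fun ζ => ‖f ζ - f η‖) (h := h) (by fun_prop) hhc
    (fun ζ => by positivity) (fun ζ hζ => by
      rw [hh, Finset.sum_eq_zero_iff_of_nonneg fun _ _ => by positivity] at hζ
      have : ζ = η := funext fun j => Circle.ext <| sub_eq_zero.1 <| by
        simpa using hζ j (Finset.mem_univ j)
      simp [this]) (half_pos hε)
  have hlim : Tendsto (fun r : ℝ => ε / 2 + K * (n * (2 - 2 * r))) (𝓝[<] 1) (𝓝 (ε / 2)) := by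
    have : Continuous fun r : ℝ => ε / 2 + K * (n * (2 - 2 * r)) := by fun_prop
    simpa using (this.tendsto 1).mono_left nhdsWithin_le_nhds
  filter_upwards [hlim.eventually_lt_const (half_lt_self hε), self_mem_nhdsWithin,
    nhdsWithin_le_nhds (Ioi_mem_nhds (zero_lt_one' ℝ))] with r hr hr1 hr0
  refine lt_of_le_of_lt ?_ hr
  have hr0 : 0 ≤ r := le_of_lt hr0
  have hz := smul_toComplex_mem_polydisc hr0 hr1 η
  have hpc := continuous_realPoissonKernel hz
  have hone : ∫ ζ, (realPoissonKernel ((r : ℂ) • η.toComplex) ζ : ℂ) ∂torusMeasure n = 1 := by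
    rw [integral_complex_ofReal, integral_realPoissonKernel hz, Complex.ofReal_one]
  have e1 : (∫ ζ, (realPoissonKernel ((r : ℂ) • η.toComplex) ζ : ℂ) * f ζ ∂torusMeasure n) - f η =
      ∫ ζ, (realPoissonKernel ((r : ℂ) • η.toComplex) ζ : ℂ) * (f ζ - f η) ∂torusMeasure n := by
    simp only [mul_sub]
    rw [integral_sub (integrable_of_continuous (by fun_prop))
      (integrable_of_continuous (by fun_prop)), integral_mul_const, hone, one_mul]
  have e2 : ∫ ζ, realPoissonKernel ((r : ℂ) • η.toComplex) ζ * (ε / 2 + K * h ζ) ∂torusMeasure n =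
      ε / 2 + K * (n * (2 - 2 * r)) := by
    have : ∀ ζ, realPoissonKernel ((r : ℂ) • η.toComplex) ζ * (ε / 2 + K * h ζ) =
        realPoissonKernel ((r : ℂ) • η.toComplex) ζ * (ε / 2) +
        K * ∑ j, realPoissonKernel ((r : ℂ) • η.toComplex) ζ * ‖(ζ j : ℂ) - η j‖ ^ 2 := fun ζ => by
      rw [← Finset.mul_sum]; ring
    simp only [this]
    have hj : ∀ j, Continuous fun ζ : Torus n =>
        realPoissonKernel ((r : ℂ) • η.toComplex) ζ * ‖(ζ j : ℂ) - η j‖ ^ 2 := fun j =>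
      hpc.mul ((((continuous_subtype_val.comp (continuous_apply j)).sub continuous_const).norm).pow 2)
    rw [integral_add (integrable_of_continuous (by fun_prop))
      (integrable_of_continuous (by fun_prop)), integral_mul_const, integral_const_mul,
      integral_finsetSum _ fun j _ => integrable_of_continuous (hj j),
      integral_realPoissonKernel hz]
    simp only [integral_realPoissonKernel_mul_sq hr0 hr1, Finset.sum_const,
      Finset.card_univ, Fintype.card_fin, nsmul_eq_mul, one_mul]
  rw [dist_eq_norm, e1, ← e2]
  refine norm_integral_le_of_norm_le (integrable_of_continuous (by fun_prop))
    (.of_forall fun ζ => ?_)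
  rw [norm_mul, Complex.norm_real, Real.norm_of_nonneg (realPoissonKernel_nonneg hz ζ)]
  exact mul_le_mul_of_nonneg_left (hle ζ) (realPoissonKernel_nonneg hz ζ)

/-! ### Recovering a measure from its Poisson integral -/

theorem poissonIntegral_eq {n : ℕ} (μ : Measure (Torus n)) {z : Fin n → ℂ} (hz : z ∈ polydisc n) :
    poissonIntegral μ z = ((∫ ζ, realPoissonKernel z ζ ∂μ : ℝ) : ℂ) := by
  simp only [poissonIntegral, torusPoissonKernel_eq hz]
  exact integral_complex_ofReal

theorem continuous_uncurry_realPoissonKernel {n : ℕ} {r : ℝ} (h0 : 0 ≤ r) (h1 : r < 1) :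
    Continuous fun p : Torus n × Torus n => realPoissonKernel ((r : ℂ) • p.1.toComplex) p.2 := by
  refine continuous_finsetProd _ fun j _ => Complex.continuous_re.comp ?_
  have ha : Continuous fun p : Torus n × Torus n => ((p.2 j : Circle) : ℂ) :=
    continuous_subtype_val.comp ((continuous_apply j).comp continuous_snd)
  have hb : Continuous fun p : Torus n × Torus n => ((r : ℂ) • p.1.toComplex) j :=
    continuous_const.mul (continuous_subtype_val.comp ((continuous_apply j).comp continuous_fst))
  exact (ha.add hb).div (ha.sub hb) fun p =>
    circle_sub_ne_zero (smul_toComplex_mem_polydisc h0 h1 p.1 j) (p.2 j)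

theorem exists_norm_le {n : ℕ} {f : Torus n → ℂ} (hf : Continuous f) : ∃ M, ∀ ζ, ‖f ζ‖ ≤ M := by
  obtain ⟨M, hM⟩ := isCompact_univ.exists_bound_of_continuousOn hf.continuousOn
  exact ⟨M, fun ζ => hM ζ (Set.mem_univ ζ)⟩

/-- Finite measures are weak limits of the dilations of their Poisson integrals. -/
theorem tendsto_integral_mul_poissonIntegral {n : ℕ} (μ : Measure (Torus n)) [IsFiniteMeasure μ]
    {f : Torus n → ℂ} (hf : Continuous f) :
    Tendsto (fun r : ℝ => ∫ ζ, f ζ * poissonIntegral μ ((r : ℂ) • ζ.toComplex) ∂torusMeasure n)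
      (𝓝[<] 1) (𝓝 (∫ ζ, f ζ ∂μ)) := by
  obtain ⟨M, hM⟩ := exists_norm_le hf
  have hmem : ∀ᶠ r : ℝ in 𝓝[<] 1, 0 ≤ r ∧ r < 1 := by
    filter_upwards [self_mem_nhdsWithin, nhdsWithin_le_nhds (Ioi_mem_nhds (zero_lt_one' ℝ))]
      with r h1 h0 using ⟨le_of_lt h0, h1⟩
  have hcont : ∀ {r : ℝ}, 0 ≤ r → r < 1 → Continuous fun p : Torus n × Torus n =>
      (realPoissonKernel ((r : ℂ) • p.1.toComplex) p.2 : ℂ) * f p.2 := fun h0 h1 =>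
    (Complex.continuous_ofReal.comp (continuous_uncurry_realPoissonKernel h0 h1)).mul
      (hf.comp continuous_snd)
  -- Fubini and the symmetry of the kernel move the Poisson operator from μ onto f. The resulting
  -- functions of η are bounded by M, since the kernel is nonnegative of mass 1, and converge
  -- pointwise to f.
  have key : Tendsto (fun r : ℝ => ∫ η, ∫ ζ, (realPoissonKernel ((r : ℂ) • η.toComplex) ζ : ℂ) * f ζ
      ∂torusMeasure n ∂μ) (𝓝[<] 1) (𝓝 (∫ ζ, f ζ ∂μ)) := by
    refine tendsto_integral_filter_of_dominated_convergence (fun _ => M) ?_ ?_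
      (integrable_const _) (.of_forall fun η => tendsto_integral_realPoissonKernel_mul hf η)
    · filter_upwards [hmem] with r hr
      exact (hcont hr.1 hr.2).aestronglyMeasurable.integral_prod_right'
    · filter_upwards [hmem] with r hr
      refine .of_forall fun η => ?_
      have hz := smul_toComplex_mem_polydisc hr.1 hr.2 η
      have hpc := continuous_realPoissonKernel hz
      calc _ ≤ ∫ ζ, realPoissonKernel ((r : ℂ) • η.toComplex) ζ * M ∂torusMeasure n := by
            refine norm_integral_le_of_norm_le (integrable_of_continuous (by fun_prop))
              (.of_forall fun ζ => ?_)
            rw [norm_mul, Complex.norm_real, Real.norm_of_nonneg (realPoissonKernel_nonneg hz ζ)]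
            exact mul_le_mul_of_nonneg_left (hM ζ) (realPoissonKernel_nonneg hz ζ)
        _ = M := by rw [integral_mul_const, integral_realPoissonKernel hz, one_mul]
  refine key.congr' ?_
  filter_upwards [hmem] with r hr
  rw [integral_integral_swap (integrable_of_continuous (hcont hr.1 hr.2))]
  refine integral_congr_ae (.of_forall fun ζ => ?_)
  dsimp only
  rw [poissonIntegral_eq μ (smul_toComplex_mem_polydisc hr.1 hr.2 ζ), ← integral_complex_ofReal,
    ← integral_const_mul]
  refine integral_congr_ae (.of_forall fun η => ?_)
  dsimp only
  rw [realPoissonKernel_symm, mul_comm]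

/-- A finite measure on the torus is determined by its Poisson integral. -/
theorem measure_eq_of_poissonIntegral_eq {n : ℕ} {μ ν : Measure (Torus n)} [IsFiniteMeasure μ]
    [IsFiniteMeasure ν] (h : ∀ z ∈ polydisc n, poissonIntegral μ z = poissonIntegral ν z) :
    μ = ν := by
  refine ext_of_forall_integral_eq_of_IsFiniteMeasure fun f => ?_
  have hf : Continuous fun ζ => (f ζ : ℂ) := Complex.continuous_ofReal.comp f.continuous
  have h1 := tendsto_integral_mul_poissonIntegral μ hf
  have h2 := tendsto_integral_mul_poissonIntegral ν hf
  have := tendsto_nhds_unique (h1.congr' ?_) h2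
  · rwa [integral_complex_ofReal, integral_complex_ofReal, Complex.ofReal_inj] at this
  · filter_upwards [self_mem_nhdsWithin, nhdsWithin_le_nhds (Ioi_mem_nhds (zero_lt_one' ℝ))]
      with r h1 h0
    refine integral_congr_ae (.of_forall fun ζ => ?_)
    dsimp only
    rw [h _ (smul_toComplex_mem_polydisc (le_of_lt h0) h1 ζ)]

/-! ### Herglotz's theorem on the polydisc -/

theorem isOpen_polydisc (n : ℕ) : IsOpen (polydisc n) := by
  simp only [polydisc, Set.ofPred_forall]
  exact isOpen_iInter_of_finite fun j => isOpen_lt (by fun_prop) continuous_const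

theorem smul_mem_polydisc {n : ℕ} {r : ℝ} (h0 : 0 < r) {z : Fin n → ℂ}
    (hz : z ∈ radiusPolydisc n r⁻¹) : (r : ℂ) • z ∈ polydisc n := fun j => by
  rw [Pi.smul_apply, norm_smul, Complex.norm_real, Real.norm_of_nonneg h0.le]
  calc r * ‖z j‖ < r * r⁻¹ := mul_lt_mul_of_pos_left (hz j) h0
    _ = 1 := mul_inv_cancel₀ h0.ne'

theorem zero_mem_polydisc (n : ℕ) : (0 : Fin n → ℂ) ∈ polydisc n := fun j => by simp

theorem differentiableOn_comp_smul {n : ℕ} {H : (Fin n → ℂ) → ℂ}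
    (hH : DifferentiableOn ℂ H (polydisc n)) {r : ℝ} (h0 : 0 < r) :
    DifferentiableOn ℂ (fun z => H ((r : ℂ) • z)) (radiusPolydisc n r⁻¹) :=
  hH.comp (by fun_prop) fun _ hz => smul_mem_polydisc h0 hz

theorem integral_realPoissonKernel_mul_re_smul {n : ℕ} {H : (Fin n → ℂ) → ℂ}
    (hH : DifferentiableOn ℂ H (polydisc n)) {r : ℝ} (h0 : 0 < r) (h1 : r < 1)
    {z : Fin n → ℂ} (hz : z ∈ polydisc n) :
    ∫ ζ, realPoissonKernel z ζ * (H ((r : ℂ) • ζ.toComplex)).re ∂torusMeasure n =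
      (H ((r : ℂ) • z)).re :=
  integral_realPoissonKernel_mul_re ((one_lt_inv₀ h0).2 h1) (differentiableOn_comp_smul hH h0) hz

theorem realPoissonKernel_zero {n : ℕ} (ζ : Torus n) : realPoissonKernel 0 ζ = 1 := by
  simp [realPoissonKernel, discPoissonKernel]

theorem continuous_comp_smul_toComplex {n : ℕ} {H : (Fin n → ℂ) → ℂ}
    (hH : ContinuousOn H (polydisc n)) {r : ℝ} (h0 : 0 < r) (h1 : r < 1) :
    Continuous fun ζ : Torus n => H ((r : ℂ) • ζ.toComplex) :=
  hH.comp_continuous ((continuous_const_smul (r : ℂ)).comp continuous_toComplex)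
    fun ζ => smul_toComplex_mem_polydisc h0.le h1 ζ

/-- The measure has density Re H(rζ) with respect to mₙ; H(r·) is holomorphic past the closed
polydisc, so the Poisson formula applies. At z = 0 the kernel is 1, which gives a mass bound
independent of r, as needed for compactness. -/
theorem exists_finiteMeasure_of_re_nonneg_dilation {n : ℕ} {H : (Fin n → ℂ) → ℂ}
    (hH : DifferentiableOn ℂ H (polydisc n)) (hre : ∀ z ∈ polydisc n, 0 ≤ (H z).re)
    (r : ℝ) (hr : 0 < r ∧ r < 1) :
    ∃ μ : FiniteMeasure (Torus n), μ.mass ≤ (H 0).re.toNNReal ∧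
      ∀ z ∈ polydisc n, ∫ ζ, realPoissonKernel z ζ ∂(μ : Measure (Torus n)) =
        (H ((r : ℂ) • z)).re := by
  obtain ⟨h0, h1⟩ := hr
  set u : Torus n → ℝ := fun ζ => (H ((r : ℂ) • ζ.toComplex)).re with hu
  have hu0 : ∀ ζ, 0 ≤ u ζ := fun ζ => hre _ (smul_toComplex_mem_polydisc h0.le h1 ζ)
  have huc : Continuous u :=
    Complex.continuous_re.comp (continuous_comp_smul_toComplex hH.continuousOn h0 h1)
  have hmass : (torusMeasure n).withDensity (fun ζ => ENNReal.ofReal (u ζ)) Set.univ =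
      ENNReal.ofReal (H 0).re := by
    rw [withDensity_apply _ MeasurableSet.univ, Measure.restrict_univ,
      ← ofReal_integral_eq_lintegral_ofReal (integrable_of_continuous huc) (.of_forall hu0)]
    have := integral_realPoissonKernel_mul_re_smul hH h0 h1 (zero_mem_polydisc n)
    simp only [realPoissonKernel_zero, one_mul, smul_zero] at this
    rw [hu, this]
  refine ⟨⟨(torusMeasure n).withDensity fun ζ => ENNReal.ofReal (u ζ),
    ⟨by rw [hmass]; exact ENNReal.ofReal_lt_top⟩⟩, ?_, fun z hz => ?_⟩
  · exact ENNReal.toNNReal_mono ENNReal.ofReal_ne_top hmass.le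
  · rw [← integral_realPoissonKernel_mul_re_smul hH h0 h1 hz]
    refine (integral_withDensity_eq_integral_toReal_smul (by fun_prop)
      (.of_forall fun _ => ENNReal.ofReal_lt_top) _).trans ?_
    refine integral_congr_ae (.of_forall fun ζ => ?_)
    dsimp only
    rw [ENNReal.toReal_ofReal (hu0 ζ), smul_eq_mul, mul_comm]

/-- Herglotz's theorem on the polydisc: a nonnegative real part of a holomorphic function is the
Poisson integral of a finite measure. -/
theorem exists_measure_of_re_nonneg {n : ℕ} {H : (Fin n → ℂ) → ℂ}
    (hH : DifferentiableOn ℂ H (polydisc n)) (hre : ∀ z ∈ polydisc n, 0 ≤ (H z).re) :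
    ∃ μ : Measure (Torus n), IsFiniteMeasure μ ∧
      ∀ z ∈ polydisc n, ∫ ζ, realPoissonKernel z ζ ∂μ = (H z).re := by
  choose! μ hmass hμ using exists_finiteMeasure_of_re_nonneg_dilation hH hre
  have hmem : ∀ᶠ r : ℝ in 𝓝[<] 1, 0 < r ∧ r < 1 := by
    filter_upwards [self_mem_nhdsWithin, nhdsWithin_le_nhds (Ioi_mem_nhds (zero_lt_one' ℝ))]
      with r h1 h0 using ⟨h0, h1⟩
  -- Finite measures of bounded mass on the compact torus form a weakly compact set, so along an
  -- ultrafilter finer than r → 1⁻ the measures converge without extraction of a subsequence.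
  set U : Ultrafilter ℝ := Ultrafilter.of (𝓝[<] (1 : ℝ)) with hU
  have hUle : (U : Filter ℝ) ≤ 𝓝[<] (1 : ℝ) := Ultrafilter.of_le _
  have hbdd : ∀ᶠ r in (U : Filter ℝ), (μ r).mass ≤ (H 0).re.toNNReal :=
    (hmem.filter_mono hUle).mono hmass
  obtain ⟨ν, -, hν⟩ :=
    (isCompact_setOfPred_finiteMeasure_le_of_compactSpace (Torus n)
      (H 0).re.toNNReal).ultrafilter_le_nhds' (U.map μ) hbdd
  have hν : Tendsto μ U (𝓝 ν) := hν
  refine ⟨ν, inferInstance, fun z hz => ?_⟩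
  have h1 := FiniteMeasure.tendsto_iff_forall_integral_tendsto.1 hν
    (BoundedContinuousFunction.mkOfCompact ⟨realPoissonKernel z, continuous_realPoissonKernel hz⟩)
  refine tendsto_nhds_unique h1 ?_
  have hlim : Tendsto (fun r : ℝ => (H ((r : ℂ) • z)).re) (𝓝[<] 1) (𝓝 (H z).re) := by
    have hc : ContinuousAt H z := hH.continuousOn.continuousAt ((isOpen_polydisc n).mem_nhds hz)
    have hs : Tendsto (fun r : ℝ => (r : ℂ) • z) (𝓝 1) (𝓝 z) := by
      have : Continuous fun r : ℝ => (r : ℂ) • z := by fun_prop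
      simpa using this.tendsto 1
    exact (Complex.continuous_re.tendsto _).comp
      ((hc.tendsto.comp hs).mono_left nhdsWithin_le_nhds)
  refine (hlim.mono_left hUle).congr' ?_
  filter_upwards [hmem.filter_mono hUle] with r hr using (hμ r hr z hz).symm

/-! ### Clark measures and their disintegration -/

/-- The change of viewpoint behind the disintegration: the Clark density at w = φ(z) is a Poisson
kernel in the variable α. -/
theorem re_herglotz_eq (α : Circle) (w : ℂ) :
    (((α : ℂ) + w) / ((α : ℂ) - w)).re = discPoissonKernel w α := rfl

theorem discPoissonKernel_nonneg {w : ℂ} (hw : ‖w‖ < 1) (α : Circle) :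
    0 ≤ discPoissonKernel w α := by
  rw [discPoissonKernel, re_add_div_sub, Circle.norm_coe]
  exact div_nonneg (by nlinarith [norm_nonneg w]) (by positivity)

theorem discPoissonKernel_le {w : ℂ} (hw : ‖w‖ < 1) (α : Circle) :
    discPoissonKernel w α ≤ 2 / (1 - ‖w‖) := by
  refine (Complex.re_le_norm _).trans ?_
  have h1 := norm_add_le (α : ℂ) w
  have h2 := norm_sub_norm_le (α : ℂ) w
  rw [Circle.norm_coe] at h1 h2
  rw [norm_div]
  exact div_le_div₀ zero_le_two (by linarith) (by linarith) h2

theorem integral_discPoissonKernel {w : ℂ} (hw : ‖w‖ < 1) :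
    ∫ α, (discPoissonKernel w α : ℂ) ∂circleMeasure = 1 := by
  simpa using integral_discPoissonKernel_mul (differentiableOn_const (c := (1 : ℂ))) hw

section Clark

variable {n : ℕ} {φ : (Fin n → ℂ) → ℂ}

theorem differentiableOn_herglotz (hφ : DifferentiableOn ℂ φ (polydisc n))
    (hmaps : Set.MapsTo φ (polydisc n) (Metric.ball 0 1)) (α : Circle) :
    DifferentiableOn ℂ (fun z => ((α : ℂ) + φ z) / ((α : ℂ) - φ z)) (polydisc n) := by
  simp only [div_eq_mul_inv]
  exact (hφ.const_add _).mul <| (hφ.const_sub _).fun_inv fun _ hz =>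
    circle_sub_ne_zero (mem_ball_zero_iff.1 (hmaps hz)) α

theorem exists_isClarkMeasure (hφ : DifferentiableOn ℂ φ (polydisc n))
    (hmaps : Set.MapsTo φ (polydisc n) (Metric.ball 0 1)) (α : Circle) :
    ∃ μ, IsClarkMeasure φ α μ := by
  obtain ⟨μ, hfin, hμ⟩ := exists_measure_of_re_nonneg (differentiableOn_herglotz hφ hmaps α)
    fun z hz => discPoissonKernel_nonneg (mem_ball_zero_iff.1 (hmaps hz)) α
  exact ⟨μ, hfin, fun z hz => by rw [poissonIntegral_eq μ hz, hμ z hz]⟩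

theorem isClarkMeasure_clarkMeasure (hφ : DifferentiableOn ℂ φ (polydisc n))
    (hmaps : Set.MapsTo φ (polydisc n) (Metric.ball 0 1)) (α : Circle) :
    IsClarkMeasure φ α (clarkMeasure φ α) := by
  have h := exists_isClarkMeasure hφ hmaps α
  rw [clarkMeasure, dif_pos h]
  exact h.choose_spec

theorem IsClarkMeasure.unique {α : Circle} {μ ν : Measure (Torus n)} (hμ : IsClarkMeasure φ α μ)
    (hν : IsClarkMeasure φ α ν) : μ = ν :=
  have := hμ.isFiniteMeasure
  have := hν.isFiniteMeasure
  measure_eq_of_poissonIntegral_eq fun z hz =>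
    (hμ.poissonIntegral_eq z hz).trans (hν.poissonIntegral_eq z hz).symm

theorem tendsto_integral_mul_discPoissonKernel {α : Circle} {μ : Measure (Torus n)}
    (hμ : IsClarkMeasure φ α μ) {f : Torus n → ℂ} (hf : Continuous f) :
    Tendsto (fun r : ℝ => ∫ ζ, f ζ * (discPoissonKernel (φ ((r : ℂ) • ζ.toComplex)) α : ℂ)
      ∂torusMeasure n) (𝓝[<] 1) (𝓝 (∫ ζ, f ζ ∂μ)) := by
  have := hμ.isFiniteMeasure
  refine (tendsto_integral_mul_poissonIntegral μ hf).congr' ?_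
  filter_upwards [self_mem_nhdsWithin, nhdsWithin_le_nhds (Ioi_mem_nhds (zero_lt_one' ℝ))]
    with r h1 h0
  refine integral_congr_ae (.of_forall fun ζ => ?_)
  dsimp only
  rw [hμ.poissonIntegral_eq _ (smul_toComplex_mem_polydisc (le_of_lt h0) h1 ζ), re_herglotz_eq]

/-- The approximants `G k` are measurable in α, uniformly bounded and have α-mean ∫ f dmₙ exactly.
Their pointwise limit inherits measurability and the bound, and dominated convergence passes the
mean to the limit. -/
theorem clarkMeasure_disintegration (hφ : DifferentiableOn ℂ φ (polydisc n))
    (hmaps : Set.MapsTo φ (polydisc n) (Metric.ball 0 1)) {f : Torus n → ℂ} (hf : Continuous f) :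
    Integrable (fun α : Circle => ∫ ζ, f ζ ∂(clarkMeasure φ α)) circleMeasure ∧
      ∫ α, (∫ ζ, f ζ ∂(clarkMeasure φ α)) ∂circleMeasure = ∫ ζ, f ζ ∂(torusMeasure n) := by
  obtain ⟨M, hM⟩ := exists_norm_le hf
  have hM0 : 0 ≤ M := (norm_nonneg _).trans (hM fun _ => 1)
  have hball : ∀ z ∈ polydisc n, ‖φ z‖ < 1 := fun z hz => mem_ball_zero_iff.1 (hmaps hz)
  obtain ⟨r, -, hr, hr1⟩ := exists_seq_strictMono_tendsto' (zero_lt_one' ℝ)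
  have hr1 : Tendsto r atTop (𝓝[<] 1) :=
    tendsto_nhdsWithin_iff.2 ⟨hr1, .of_forall fun k => (hr k).2⟩
  set G : ℕ → Circle → ℂ := fun k α =>
    ∫ ζ, f ζ * (discPoissonKernel (φ ((r k : ℂ) • ζ.toComplex)) α : ℂ) ∂torusMeasure n with hG
  have hlim : ∀ α, Tendsto (fun k => G k α) atTop (𝓝 (∫ ζ, f ζ ∂(clarkMeasure φ α))) := fun α =>
    (tendsto_integral_mul_discPoissonKernel (isClarkMeasure_clarkMeasure hφ hmaps α) hf).comp hr1
  have hcont : ∀ k, Continuous fun p : Circle × Torus n =>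
      f p.2 * (discPoissonKernel (φ ((r k : ℂ) • p.2.toComplex)) p.1 : ℂ) := fun k => by
    have ha : Continuous fun p : Circle × Torus n => (p.1 : ℂ) :=
      continuous_subtype_val.comp continuous_fst
    have hb : Continuous fun p : Circle × Torus n => φ ((r k : ℂ) • p.2.toComplex) :=
      (continuous_comp_smul_toComplex hφ.continuousOn (hr k).1 (hr k).2).comp continuous_snd
    exact (hf.comp continuous_snd).mul <| Complex.continuous_ofReal.comp <|
      Complex.continuous_re.comp <| (ha.add hb).div (ha.sub hb) fun p =>
        circle_sub_ne_zero (hball _ (smul_toComplex_mem_polydisc (hr k).1.le (hr k).2 p.2)) p.1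
  have hmeas : ∀ k, AEStronglyMeasurable (G k) circleMeasure := fun k =>
    (hcont k).aestronglyMeasurable.integral_prod_right'
  -- The density is nonnegative, and its mean over the torus is its value at z = 0 whatever k is; |α
  -- - φ(0)| ≥ 1 - |φ(0)| then makes the bound uniform in α as well.
  have hbound : ∀ k α, ‖G k α‖ ≤ M * (2 / (1 - ‖φ 0‖)) := fun k α => by
    have hu : Continuous fun ζ : Torus n => discPoissonKernel (φ ((r k : ℂ) • ζ.toComplex)) α :=
      Complex.continuous_re.comp (continuous_comp_smul_toComplex
        (differentiableOn_herglotz hφ hmaps α).continuousOn (hr k).1 (hr k).2)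
    have hmean := integral_realPoissonKernel_mul_re_smul (differentiableOn_herglotz hφ hmaps α)
      (hr k).1 (hr k).2 (zero_mem_polydisc n)
    simp only [realPoissonKernel_zero, one_mul, smul_zero, re_herglotz_eq] at hmean
    calc ‖G k α‖ ≤ ∫ ζ, M * discPoissonKernel (φ ((r k : ℂ) • ζ.toComplex)) α ∂torusMeasure n := by
          refine norm_integral_le_of_norm_le (integrable_of_continuous (by fun_prop))
            (.of_forall fun ζ => ?_)
          have h0 := discPoissonKernel_nonneg
            (hball _ (smul_toComplex_mem_polydisc (hr k).1.le (hr k).2 ζ)) α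
          rw [norm_mul, Complex.norm_real, Real.norm_of_nonneg h0]
          exact mul_le_mul_of_nonneg_right (hM ζ) h0
      _ = M * discPoissonKernel (φ 0) α := by rw [integral_const_mul, hmean]
      _ ≤ _ := mul_le_mul_of_nonneg_left
        (discPoissonKernel_le (hball _ (zero_mem_polydisc n)) α) hM0
  have hint : ∀ k, ∫ α, G k α ∂circleMeasure = ∫ ζ, f ζ ∂torusMeasure n := fun k => by
    rw [hG, integral_integral_swap (integrable_of_continuous (hcont k))]
    refine integral_congr_ae (.of_forall fun ζ => ?_)
    dsimp only
    rw [integral_const_mul, integral_discPoissonKernel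
      (hball _ (smul_toComplex_mem_polydisc (hr k).1.le (hr k).2 ζ)), mul_one]
  refine ⟨.of_bound (aestronglyMeasurable_of_tendsto_ae atTop hmeas (.of_forall hlim))
    (M * (2 / (1 - ‖φ 0‖))) (.of_forall fun α => le_of_tendsto (hlim α).norm
      (.of_forall fun k => hbound k α)), ?_⟩
  have := tendsto_integral_of_dominated_convergence (fun _ => M * (2 / (1 - ‖φ 0‖))) hmeas
    (integrable_const _) (fun k => .of_forall (hbound k)) (.of_forall hlim)
  simp only [hint] at this
  exact tendsto_nhds_unique this tendsto_const_nhds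

end Clark

end ClarkTorus

theorem proposition2p4 (n : ℕ) (φ : (Fin n → ℂ) → ℂ)
    (hφ : DifferentiableOn ℂ φ (ClarkTorus.polydisc n))
    (hmaps : Set.MapsTo φ (ClarkTorus.polydisc n) (Metric.ball (0 : ℂ) 1)) :
    -- the Clark measures are well defined: existence and uniqueness for each `α`
    (∀ α : Circle,
      ClarkTorus.IsClarkMeasure φ α (ClarkTorus.clarkMeasure φ α) ∧
        ∀ μ : Measure (ClarkTorus.Torus n), ClarkTorus.IsClarkMeasure φ α μ →
          μ = ClarkTorus.clarkMeasure φ α) ∧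
    -- the disintegration formula
    ∀ f : C(ClarkTorus.Torus n, ℂ),
      Integrable (fun α : Circle => ∫ ζ, f ζ ∂(ClarkTorus.clarkMeasure φ α))
        ClarkTorus.circleMeasure ∧
      ∫ α, (∫ ζ, f ζ ∂(ClarkTorus.clarkMeasure φ α)) ∂ClarkTorus.circleMeasure =
        ∫ ζ, f ζ ∂(ClarkTorus.torusMeasure n) :=
  ⟨fun α =>
    have h := ClarkTorus.isClarkMeasure_clarkMeasure hφ hmaps α
    ⟨h, fun _ hμ => hμ.unique h⟩,
  fun f => ClarkTorus.clarkMeasure_disintegration hφ hmaps f.continuous⟩
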